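/- Let $A$ be a unital C*-algebra, and let $\mathcal C(A)$ be the poset of its unital commutative C*-subalgebras (norm-closed commutative *-subalgebras containing $1_A$), ordered by inclusion. Let $\mathcal T(A)=\mathbf{Sets}^{\mathcal C(A)}$ be the topos of functors $\mathcal C(A)\to\mathbf{Sets}$; its subobject classifier $\underline\Omega$ assigns to $C$ the set of upper sets of $\uparrow C=\{D\mid C\subseteq D\}$, and formulas are interpreted in its internal (Mitchell–Bénabou) language. Let $\underline A\in\mathcal T(A)$ be the tautological functor $C\mapsto C$, with the inclusions as transition maps. (1) The object $\mathrm{Pt}(\underline{\mathbb C})=\mathrm{Pt}(\underline{\mathbb R})\times\mathrm{Pt}(\underline{\mathbb R})$ of internal Dedekind complex numbers, where $\mathrm{Pt}(\underline{\mathbb R})\subseteq\mathcal P(\underline{\mathbb Q})\times\mathcal P(\underline{\mathbb Q})$ is the object of Dedekind cuts, is the constant functor $C\mapsto\mathbb C$: the canonical arrow from this constant functor to $\mathrm{Pt}(\underline{\mathbb C})$ is an isomorphism, and it carries the pointwise addition, multiplication and conjugation to the operations on $\mathrm{Pt}(\underline{\mathbb C})$ given by the usual arithmetic of Dedekind cuts.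 (2) There are arrows of $\mathcal T(A)$ $$0,1:\underline 1\to\underline A,\quad +:\underline A\times\underline A\to\underline A,\quad -:\underline A\to\underline A,\quad \cdot:\mathrm{Pt}(\underline{\mathbb C})\times\underline A\to\underline A,\quad \cdot:\underline A\times\underline A\to\underline A,\quad {}^*:\underline A\to\underline A,$$ and $N:\underline A\times\underline{\mathbb Q}^+\to\underline\Omega$, whose components at each $C\in\mathcal C(A)$ are the zero, unit, sum, negative, scalar multiple, product and adjoint of $A$ restricted to $C$, and are such that $N_C(a,q)$ is true (the maximal element of $\underline\Omega(C)$) if and only if $\|a\|<q$, for all $a\in C$ and rational $q>0$. (3) With this structure $\underline A$ is, internally to $\mathcal T(A)$, a unital commutative *-algebra over $\mathrm{Pt}(\underline{\mathbb C})$ (a vector space with an associative bilinear multiplication with unit, and a conjugate-linear involution reversing products), and, with scalars restricted to the Gaussian numbers $\mathbb C_{\mathbb Q}=\{p+qi\mid p,q\in\mathbb Q\}$ (as a constant functor), a unital commutative C*-algebra. That is, the following hold in the internal language, for all $a,b\in\underline A$, $p,q\in\underline{\mathbb Q}^+$ and $z\in\underline{\mathbb C_{\mathbb Q}}$. - $N$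 is a seminorm relation: $(0,p)\in N$; $\exists q\,(a,q)\in N$; $(a,p)\in N\to(a^*,p)\in N$; $(a,q)\in N\leftrightarrow\exists p<q\,(a,p)\in N$; $(a,p)\in N\wedge(b,q)\in N\to(a+b,p+q)\in N\wedge(ab,pq)\in N$; $|z|<q\wedge(a,p)\in N\to(za,pq)\in N$; $p>1\to(1,p)\in N$. Moreover $(a^*a,q^2)\in N\leftrightarrow(a,q)\in N$. - $N$ is a norm: $(\forall q\,(a,q)\in N)\to a=0$. - $\underline A$ is complete: every Cauchy approximation converges. Here a Cauchy approximation is a sequence $(S_n)$ of subobjects of $\underline A$ with $\forall n\,\exists x\; x\in S_n$ and $\forall\varepsilon\in\underline{\mathbb Q}^+\,\exists m\,\forall n,n'\ge m\,\forall x,x'\,(x\in S_n\wedge x'\in S_{n'}\to(x-x',\varepsilon)\in N)$, and it converges to $y$ if $\forall\varepsilon\in\underline{\mathbb Q}^+\,\exists m\,\forall n\ge m\,\forall x\,(x\in S_n\to(x-y,\varepsilon)\in N)$. -/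

import Mathlib

open CategoryTheory MonoidalCategory CartesianMonoidalCategory

universe u

noncomputable section

namespace FunctorTopos

/-! ## The topos `P ⥤ Type u` of set-valued functors on a poset and its internal language

Formulas in a context `X` are arrows `X ⟶ Omega P`, terms of type `Y` in a context `X` are arrows
`X ⟶ Y`, and contexts are left-nested products of objects. -/

variable {P : Type u} [Preorder P]

theorem types_ext {S T : Type u} {f g : S ⟶ T} (h : ∀ x : S, f x = g x) : f = g :=
  ConcreteCategory.hom_ext f g h

/-- Restriction along `C ≤ D` of an element of a functor `X` at stage `C`. -/
def res (X : P ⥤ Type u) {C D : P} (h : C ≤ D) (x : X.obj C) : X.obj D :=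
  X.map (homOfLE h) x

theorem res_self (X : P ⥤ Type u) {C : P} (h : C ≤ C) (x : X.obj C) : res X h x = x :=
  ConcreteCategory.congr_hom (X.map_id C) x

theorem res_res (X : P ⥤ Type u) {C D E : P} (h : C ≤ D) (k : D ≤ E) (x : X.obj C) :
    res X k (res X h x) = res X (h.trans k) x :=
  (ConcreteCategory.congr_hom (X.map_comp (homOfLE h) (homOfLE k)) x).symm

theorem app_res {X Y : P ⥤ Type u} (f : X ⟶ Y) {C D : P} (h : C ≤ D) (x : X.obj C) :
    f.app D (res X h x) = res Y h (f.app C x) :=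
  ConcreteCategory.congr_hom (f.naturality (homOfLE h)) x

/-- A pair of elements at stage `C`, as an element of the product. -/
def pr {X Y : P ⥤ Type u} {C : P} (x : X.obj C) (y : Y.obj C) : (X ⊗ Y).obj C := (x, y)

/-- An arrow of functors from its components. -/
def arrow {X Y : P ⥤ Type u} (f : ∀ C, X.obj C → Y.obj C)
    (hf : ∀ (C D : P) (h : C ≤ D) (x : X.obj C), f D (res X h x) = res Y h (f C x)) : X ⟶ Y where
  app C := TypeCat.ofHom (f C)
  naturality C D g := ConcreteCategory.hom_ext _ _ fun x => hf C D (leOfHom g) x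

/-! ### The subobject classifier -/

/-- An upper set of the principal upper set `↑C = {D | C ≤ D}`. -/
@[ext]
structure Cosieve (C : P) where
  carrier : Set P
  le_of_mem : ∀ ⦃D : P⦄, D ∈ carrier → C ≤ D
  upper : ∀ ⦃D E : P⦄, D ≤ E → D ∈ carrier → E ∈ carrier

/-- The maximal upper set of `↑C`. -/
def Cosieve.top (C : P) : Cosieve C where
  carrier := {D | C ≤ D}
  le_of_mem _ h := h
  upper _ _ h hD := le_trans hD h

/-- The restriction `S ↦ S ∩ ↑D`. -/
def Cosieve.restrict {C : P} (S : Cosieve C) (D : P) : Cosieve D where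
  carrier := {E | E ∈ S.carrier ∧ D ≤ E}
  le_of_mem _ h := h.2
  upper _ _ h hD := ⟨S.upper h hD.1, le_trans hD.2 h⟩

variable (P) in
/-- The subobject classifier: its value at `C` is the set of upper sets of `↑C`. -/
def Omega : P ⥤ Type u where
  obj C := Cosieve C
  map {C D} _ := TypeCat.ofHom fun S : Cosieve C => S.restrict D
  map_id C := types_ext fun (S : Cosieve C) => Cosieve.ext (x := S.restrict C) (y := S) <|
    Set.ext fun _ => ⟨fun h => h.1, fun h => ⟨h, S.le_of_mem h⟩⟩
  map_comp {C D E} _ g := types_ext fun (S : Cosieve C) =>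
    Cosieve.ext (x := S.restrict E) (y := (S.restrict D).restrict E) <| Set.ext fun _ =>
      ⟨fun h => ⟨⟨h.1, le_trans (leOfHom g) h.2⟩, h.2⟩, fun h => ⟨h.1.1, h.2⟩⟩

variable (P) in
/-- The arrow `true : 1 ⟶ Omega`. -/
def tru : 𝟙_ (P ⥤ Type u) ⟶ Omega P :=
  arrow (fun C _ => Cosieve.top C) fun _ _ h _ => Cosieve.ext <| Set.ext fun _ =>
    ⟨fun h' => ⟨le_trans h h', h'⟩, fun h' => h'.2⟩

/-- Formulas in context `X`. -/
abbrev Fm (X : P ⥤ Type u) : Type u := X ⟶ Omega P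

/-- A sentence, i.e. a formula in the empty context `1`, is valid if it equals `true`. -/
def Valid (φ : Fm (𝟙_ (P ⥤ Type u))) : Prop := φ = tru P

/-- `C` forces `φ(x)`: the truth value of `φ(x)` at stage `C` is the maximal upper set of `↑C`. -/
def Forces {X : P ⥤ Type u} (φ : Fm X) (C : P) (x : X.obj C) : Prop :=
  φ.app C x = Cosieve.top C

theorem mem_app_iff {X : P ⥤ Type u} (φ : Fm X) {C D : P} (x : X.obj C) :
    D ∈ Cosieve.carrier (φ.app C x) ↔ ∃ h : C ≤ D, Forces φ D (res X h x) := by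
  constructor
  · intro hD
    have h : C ≤ D := Cosieve.le_of_mem _ hD
    refine ⟨h, ?_⟩
    rw [Forces, app_res]
    exact Cosieve.ext <| Set.ext fun E =>
      ⟨fun hE => hE.2, fun hE => ⟨Cosieve.upper _ hE hD, hE⟩⟩
  · rintro ⟨h, hx⟩
    rw [Forces, app_res] at hx
    have : D ∈ (Cosieve.top D).carrier := le_refl D
    rw [← hx] at this
    exact this.1

theorem Forces.mono {X : P ⥤ Type u} {φ : Fm X} {C D : P} {x : X.obj C} (hx : Forces φ C x)
    (h : C ≤ D) : Forces φ D (res X h x) := by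
  have : D ∈ Cosieve.carrier (φ.app C x) := by rw [hx]; exact h
  obtain ⟨_, h'⟩ := (mem_app_iff φ x).1 this
  exact h'

/-- The subobject `{x | φ(x)}` of `X` classified by a formula `φ`. -/
def sub {X : P ⥤ Type u} (φ : Fm X) : Subfunctor X where
  obj C := {x | Forces φ C x}
  map i _ hx := Forces.mono hx (leOfHom i)

/-- The characteristic arrow of a subobject of `X`. -/
def char {X : P ⥤ Type u} (S : Subfunctor X) : Fm X :=
  arrow (fun C x =>
    ({ carrier := {D | ∃ h : C ≤ D, res X h x ∈ S.obj D}
       le_of_mem := fun _ h => h.1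
       upper := fun D E hDE ⟨h, hx⟩ => ⟨le_trans h hDE, by
        rw [← res_res X h hDE]; exact S.map (homOfLE hDE) hx⟩ } : Cosieve C))
    fun C D h x => Cosieve.ext <| Set.ext fun E =>
      ⟨fun ⟨k, hx⟩ => ⟨⟨h.trans k, by rw [← res_res X h k]; exact hx⟩, k⟩,
        fun hE => ⟨hE.2, by rw [res_res X h hE.2]; exact hE.1.2⟩⟩

theorem forces_char {X : P ⥤ Type u} (S : Subfunctor X) (C : P) (x : X.obj C) :
    Forces (char S) C x ↔ x ∈ S.obj C := by
  constructor
  · intro h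
    have : C ∈ (Cosieve.top C).carrier := le_refl C
    rw [← h] at this
    obtain ⟨k, hx⟩ := this
    rwa [res_self] at hx
  · intro hx
    exact Cosieve.ext <| Set.ext fun D =>
      ⟨fun h => h.1, fun h => ⟨h, S.map (homOfLE h) hx⟩⟩

theorem sub_char {X : P ⥤ Type u} (S : Subfunctor X) : sub (char S) = S :=
  Subfunctor.ext <| funext fun C => Set.ext fun x => forces_char S C x

theorem char_sub {X : P ⥤ Type u} (φ : Fm X) : char (sub φ) = φ := by
  refine NatTrans.ext <| funext fun C => types_ext fun x => Cosieve.ext <| Set.ext fun D => ?_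
  exact (mem_app_iff φ x).symm

theorem valid_iff (φ : Fm (𝟙_ (P ⥤ Type u))) : Valid φ ↔ ∀ C x, Forces φ C x := by
  constructor
  · rintro h C x
    rw [h]; rfl
  · intro h
    exact NatTrans.ext <| funext fun C => types_ext fun x => h C x

/-! ### Terms: variables, application of an arrow, pairs -/

section Terms

variable {Γ X₀ X₁ X₂ X₃ X₄ X₅ X₆ Y Z W : P ⥤ Type u}

/-- The last variable of a context. -/
def v0 : Γ ⊗ X₀ ⟶ X₀ := snd _ _
/-- The last variable but one, and so on. -/
def v1 : (Γ ⊗ X₁) ⊗ X₀ ⟶ X₁ := fst _ _ ≫ v0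
def v2 : ((Γ ⊗ X₂) ⊗ X₁) ⊗ X₀ ⟶ X₂ := fst _ _ ≫ v1
def v3 : (((Γ ⊗ X₃) ⊗ X₂) ⊗ X₁) ⊗ X₀ ⟶ X₃ := fst _ _ ≫ v2
def v4 : ((((Γ ⊗ X₄) ⊗ X₃) ⊗ X₂) ⊗ X₁) ⊗ X₀ ⟶ X₄ := fst _ _ ≫ v3
def v5 : (((((Γ ⊗ X₅) ⊗ X₄) ⊗ X₃) ⊗ X₂) ⊗ X₁) ⊗ X₀ ⟶ X₅ := fst _ _ ≫ v4
def v6 : ((((((Γ ⊗ X₆) ⊗ X₅) ⊗ X₄) ⊗ X₃) ⊗ X₂) ⊗ X₁) ⊗ X₀ ⟶ X₆ := fst _ _ ≫ v5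

section
variable {C D : P}

theorem v0_app (g : Γ.obj C) (a : X₀.obj C) : (v0 (Γ := Γ)).app C (pr g a) = a := rfl
theorem v1_app (g : (Γ ⊗ X₁).obj C) (a : X₀.obj C) :
    v1.app C (pr g a) = v0.app C g := rfl
theorem v2_app (g : ((Γ ⊗ X₂) ⊗ X₁).obj C) (a : X₀.obj C) :
    v2.app C (pr g a) = v1.app C g := rfl
theorem v3_app (g : (((Γ ⊗ X₃) ⊗ X₂) ⊗ X₁).obj C) (a : X₀.obj C) :
    v3.app C (pr g a) = v2.app C g := rfl
theorem v4_app (g : ((((Γ ⊗ X₄) ⊗ X₃) ⊗ X₂) ⊗ X₁).obj C) (a : X₀.obj C) :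
    v4.app C (pr g a) = v3.app C g := rfl
theorem v5_app (g : (((((Γ ⊗ X₅) ⊗ X₄) ⊗ X₃) ⊗ X₂) ⊗ X₁).obj C) (a : X₀.obj C) :
    v5.app C (pr g a) = v4.app C g := rfl
theorem v6_app (g : ((((((Γ ⊗ X₆) ⊗ X₅) ⊗ X₄) ⊗ X₃) ⊗ X₂) ⊗ X₁).obj C) (a : X₀.obj C) :
    v6.app C (pr g a) = v5.app C g := rfl
theorem res_pr (h : C ≤ D) (g : Γ.obj C) (a : X₀.obj C) :
    res (Γ ⊗ X₀) h (pr g a) = pr (res Γ h g) (res X₀ h a) := rfl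

end

/-- A constant symbol. -/
def ap₀ (f : 𝟙_ (P ⥤ Type u) ⟶ Y) : Γ ⟶ Y := toUnit Γ ≫ f
/-- Application of an arrow, as a unary function or relation symbol. -/
def ap₁ (f : Y ⟶ Z) (s : Γ ⟶ Y) : Γ ⟶ Z := s ≫ f
/-- Application of an arrow, as a binary function or relation symbol. -/
def ap₂ (f : Y ⊗ Z ⟶ W) (s : Γ ⟶ Y) (t : Γ ⟶ Z) : Γ ⟶ W := lift s t ≫ f

end Terms

/-! ### Connectives, quantifiers, equality

The connectives are the Heyting operations on subobjects; `ex Y` and `all Y` are the left and the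
right adjoint of pullback along the projection `X ⊗ Y ⟶ X`
(`le_imp_iff`, `ex_le_iff`, `le_all_iff`). -/

section Logic

variable {X Y : P ⥤ Type u}

def conj (φ ψ : Fm X) : Fm X := char (sub φ ⊓ sub ψ)

def disj (φ ψ : Fm X) : Fm X := char (sub φ ⊔ sub ψ)

def fls : Fm X := char ⊥

def imp (φ ψ : Fm X) : Fm X := char
  { obj := fun C => {x | ∀ (D : P) (h : C ≤ D), Forces φ D (res X h x) → Forces ψ D (res X h x)}
    map := fun {C D} i x hx E k hE => by
      have e : X.map i x = res X (leOfHom i) x := rfl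
      rw [e, res_res] at hE ⊢
      exact hx E _ hE }

def neg (φ : Fm X) : Fm X := imp φ fls

def equiv (φ ψ : Fm X) : Fm X := conj (imp φ ψ) (imp ψ φ)

def ex (Y : P ⥤ Type u) (φ : Fm (X ⊗ Y)) : Fm X := char ((sub φ).image (fst X Y))

def all (Y : P ⥤ Type u) (φ : Fm (X ⊗ Y)) : Fm X := char
  { obj := fun C => {x | ∀ (D : P) (h : C ≤ D) (y : Y.obj D), Forces φ D (pr (res X h x) y)}
    map := fun {C D} i x hx E k y => by
      have e : X.map i x = res X (leOfHom i) x := rfl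
      rw [e, res_res]
      exact hx E _ y }

/-- Internal equality of terms: the equalizer of `s` and `t`. -/
def eq (s t : X ⟶ Y) : Fm X := char
  { obj := fun C => {x | s.app C x = t.app C x}
    map := fun {C D} i x hx => by
      have e : X.map i x = res X (leOfHom i) x := rfl
      simp only [Set.mem_preimage, Set.mem_ofPred_eq] at hx ⊢
      rw [e, app_res, app_res, hx] }

theorem forces_conj (φ ψ : Fm X) (C : P) (x : X.obj C) :
    Forces (conj φ ψ) C x ↔ Forces φ C x ∧ Forces ψ C x := forces_char _ C x

theorem forces_disj (φ ψ : Fm X) (C : P) (x : X.obj C) :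
    Forces (disj φ ψ) C x ↔ Forces φ C x ∨ Forces ψ C x := forces_char _ C x

theorem forces_fls (C : P) (x : X.obj C) : ¬ Forces (fls : Fm X) C x :=
  fun h => (forces_char _ C x).1 h

theorem forces_imp (φ ψ : Fm X) (C : P) (x : X.obj C) : Forces (imp φ ψ) C x ↔
    ∀ (D : P) (h : C ≤ D), Forces φ D (res X h x) → Forces ψ D (res X h x) := forces_char _ C x

theorem forces_ex (φ : Fm (X ⊗ Y)) (C : P) (x : X.obj C) :
    Forces (ex Y φ) C x ↔ ∃ y : Y.obj C, Forces φ C (pr x y) := by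
  refine (forces_char _ C x).trans ⟨?_, fun ⟨y, hy⟩ => ⟨(x, y), hy, rfl⟩⟩
  rintro ⟨⟨x', y⟩, hy, rfl⟩
  exact ⟨y, hy⟩

theorem forces_all (φ : Fm (X ⊗ Y)) (C : P) (x : X.obj C) : Forces (all Y φ) C x ↔
    ∀ (D : P) (h : C ≤ D) (y : Y.obj D), Forces φ D (pr (res X h x) y) := forces_char _ C x

theorem forces_eq (s t : X ⟶ Y) (C : P) (x : X.obj C) :
    Forces (eq s t) C x ↔ s.app C x = t.app C x := forces_char _ C x

theorem le_imp_iff (χ φ ψ : Fm X) : sub χ ≤ sub (imp φ ψ) ↔ sub χ ⊓ sub φ ≤ sub ψ := by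
  constructor
  · rintro h C x ⟨hχ, hφ⟩
    have := (forces_imp φ ψ C x).1 (h C hχ) C le_rfl
    rw [res_self] at this
    exact this hφ
  · intro h C x hχ
    exact (forces_imp φ ψ C x).2 fun D k hφ => h D ⟨Forces.mono hχ k, hφ⟩

theorem ex_le_iff (φ : Fm (X ⊗ Y)) (ψ : Fm X) :
    sub (ex Y φ) ≤ sub ψ ↔ sub φ ≤ (sub ψ).preimage (fst X Y) := by
  rw [ex, sub_char, Subfunctor.image_le_iff]

theorem le_all_iff (φ : Fm (X ⊗ Y)) (ψ : Fm X) :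
    sub ψ ≤ sub (all Y φ) ↔ (sub ψ).preimage (fst X Y) ≤ sub φ := by
  constructor
  · rintro h C ⟨x, y⟩ hx
    have := (forces_all φ C x).1 (h C hx) C le_rfl y
    rwa [res_self] at this
  · intro h C x hx
    exact (forces_all φ C x).2 fun D k y => h D (Forces.mono hx k)

end Logic

/-! ### Power objects -/

/-- A subfunctor of the restriction of `Y` to `↑C`. -/
@[ext]
structure LocalSub (Y : P ⥤ Type u) (C : P) where
  obj : ∀ D : P, C ≤ D → Set (Y.obj D)
  map : ∀ (D E : P) (h : C ≤ D) (k : D ≤ E) (y : Y.obj D),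
    y ∈ obj D h → res Y k y ∈ obj E (h.trans k)

/-- The power object of `Y`: its value at `C` is the set of subfunctors of `Y` restricted to `↑C`. -/
def Pow (Y : P ⥤ Type u) : P ⥤ Type u where
  obj C := LocalSub Y C
  map {C D} f := TypeCat.ofHom fun S : LocalSub Y C =>
    ({ obj := fun E h => S.obj E ((leOfHom f).trans h)
       map := fun E F _ k y hy => S.map E F _ k y hy } : LocalSub Y D)
  map_id _ := rfl
  map_comp _ _ := rfl

/-- The membership relation. -/
def memRel (Y : P ⥤ Type u) : Fm (Y ⊗ Pow Y) := char
  { obj := fun C => {p | p.1 ∈ LocalSub.obj p.2 C le_rfl}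
    map := fun {C D} i p hp => LocalSub.map p.2 C D le_rfl (leOfHom i) p.1 hp }

/-- The formula `s ∈ S`. -/
def mem {Γ Y : P ⥤ Type u} (s : Γ ⟶ Y) (S : Γ ⟶ Pow Y) : Fm Γ := ap₂ (memRel Y) s S

theorem forces_mem {Γ Y : P ⥤ Type u} (s : Γ ⟶ Y) (S : Γ ⟶ Pow Y) (C : P) (x : Γ.obj C) :
    Forces (mem s S) C x ↔ s.app C x ∈ LocalSub.obj (S.app C x) C le_rfl :=
  forces_char _ C (pr (s.app C x) (S.app C x))

/-! ### Constant functors -/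

variable (P) in
/-- The constant functor with value `α`. -/
abbrev cst (α : Type) : P ⥤ Type u := (Functor.const P).obj (ULift.{u} α)

section Const

variable {α β γ : Type} {Γ : P ⥤ Type u}

def cst₀ (a : α) : 𝟙_ (P ⥤ Type u) ⟶ cst P α := arrow (fun _ _ => ⟨a⟩) fun _ _ _ _ => rfl

def cst₁ (f : α → β) : cst P α ⟶ cst P β := arrow (fun _ x => ⟨f x.down⟩) fun _ _ _ _ => rfl

def cst₂ (f : α → β → γ) : cst P α ⊗ cst P β ⟶ cst P γ :=
  arrow (fun _ x => ⟨f x.1.down x.2.down⟩) fun _ _ _ _ => rfl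

/-- A binary relation on sets, as a relation between constant functors. -/
def cstRel (r : α → β → Prop) : Fm (cst P α ⊗ cst P β) := char
  { obj := fun _ => {x | r x.1.down x.2.down}
    map := fun _ _ hx => hx }

theorem forces_cstRel (r : α → β → Prop) (s : Γ ⟶ cst P α) (t : Γ ⟶ cst P β) (C : P)
    (x : Γ.obj C) :
    Forces (ap₂ (cstRel r) s t) C x ↔ r (s.app C x).down (t.app C x).down :=
  forces_char _ C (pr (s.app C x) (t.app C x))

end Const

/-! ### The objects `ℕ`, `ℚ`, `ℚ⁺` and the Gaussian numbers `ℂ_ℚ = {p + qi | p, q ∈ ℚ}` -/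

/-- The positive rationals. -/
abbrev PosRat : Type := {q : ℚ // 0 < q}

/-- The field `ℂ_ℚ` of complex numbers with rational real and imaginary part. -/
def GaussRat : Subring ℂ where
  carrier := {z | ∃ p q : ℚ, z = ⟨p, q⟩}
  zero_mem' := ⟨0, 0, by simp [Complex.ext_iff]⟩
  one_mem' := ⟨1, 0, by simp [Complex.ext_iff]⟩
  add_mem' := by
    rintro _ _ ⟨p, q, rfl⟩ ⟨p', q', rfl⟩
    exact ⟨p + p', q + q', by simp [Complex.ext_iff]⟩
  mul_mem' := by
    rintro _ _ ⟨p, q, rfl⟩ ⟨p', q', rfl⟩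
    exact ⟨p * p' - q * q', p * q' + q * p', by simp [Complex.ext_iff]⟩
  neg_mem' := by
    rintro _ ⟨p, q, rfl⟩
    exact ⟨-p, -q, by simp [Complex.ext_iff]⟩

/-- Complex conjugation on `ℂ_ℚ`. -/
def GaussRat.conj (z : GaussRat) : GaussRat :=
  ⟨starRingEnd ℂ z, by
    obtain ⟨_, p, q, rfl⟩ := z
    exact ⟨p, -q, by simp [Complex.ext_iff]⟩⟩

variable (P)
/-- The object of natural numbers. -/
abbrev NatObj : P ⥤ Type u := cst P ℕ
/-- The object of rational numbers. -/
abbrev RatObj : P ⥤ Type u := cst P ℚ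
/-- The object of positive rational numbers. -/
abbrev PosRatObj : P ⥤ Type u := cst P PosRat
/-- The object of Gaussian numbers. -/
abbrev GaussObj : P ⥤ Type u := cst P GaussRat
variable {P}

/-! ### The internal Dedekind real and complex numbers -/

/-- The formula `s < t` for rationals. -/
def ltQ {Γ : P ⥤ Type u} (s t : Γ ⟶ RatObj P) : Fm Γ := ap₂ (cstRel fun p q => p < q) s t

variable (P) in
/-- `(L, U)` is a Dedekind cut of the rationals. -/
def isCut : Fm ((𝟙_ (P ⥤ Type u) ⊗ Pow (RatObj P)) ⊗ Pow (RatObj P)) :=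
  -- both `L` and `U` are inhabited
  conj (ex (RatObj P) (mem v0 v2)) <|
  conj (ex (RatObj P) (mem v0 v1)) <|
  -- `p ∈ L ↔ ∃ q, p < q ∧ q ∈ L` and `p ∈ U ↔ ∃ q, q < p ∧ q ∈ U`
  conj (all (RatObj P) <| equiv (mem v0 v2) (ex (RatObj P) <| conj (ltQ v1 v0) (mem v0 v3))) <|
  conj (all (RatObj P) <| equiv (mem v0 v1) (ex (RatObj P) <| conj (ltQ v0 v1) (mem v0 v2))) <|
  -- `L` and `U` are disjoint
  conj (all (RatObj P) <| neg (conj (mem v0 v2) (mem v0 v1))) <|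
  -- locatedness: `p < q → p ∈ L ∨ q ∈ U`
  all (RatObj P) <| all (RatObj P) <| imp (ltQ v1 v0) (disj (mem v1 v3) (mem v0 v2))

variable (P) in
/-- The subobject of `Pow ℚ ⊗ Pow ℚ` of Dedekind cuts. -/
def cuts : Subfunctor (Pow (RatObj P) ⊗ Pow (RatObj P)) :=
  sub (lift (lift (toUnit _) (fst _ _)) (snd _ _) ≫ isCut P)

variable (P) in
/-- The object `Pt(ℝ)` of Dedekind real numbers. -/
def PtReal : P ⥤ Type u := (cuts P).toFunctor

variable (P) in
/-- The object `Pt(ℂ)` of Dedekind complex numbers, `ℂ = ℝ + iℝ`. -/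
abbrev PtComplex : P ⥤ Type u := PtReal P ⊗ PtReal P

/-- The lower cut of a Dedekind real. -/
def lowerCut : PtReal P ⟶ Pow (RatObj P) := (cuts P).ι ≫ fst _ _
/-- The upper cut of a Dedekind real. -/
def upperCut : PtReal P ⟶ Pow (RatObj P) := (cuts P).ι ≫ snd _ _

/-- The pair `({p | p < x}, {q | x < q})` at stage `C`. -/
def realCut (C : P) (x : ℝ) : (Pow (RatObj P) ⊗ Pow (RatObj P)).obj C :=
  (({ obj := fun _ _ => {p | (p.down : ℝ) < x}, map := fun _ _ _ _ _ h => h } :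
      LocalSub (RatObj P) C),
    ({ obj := fun _ _ => {q | x < (q.down : ℝ)}, map := fun _ _ _ _ _ h => h } :
      LocalSub (RatObj P) C))

theorem forces_equiv {X : P ⥤ Type u} (φ ψ : Fm X) (C : P) (x : X.obj C) :
    Forces (equiv φ ψ) C x ↔
      ∀ (D : P) (h : C ≤ D), Forces φ D (res X h x) ↔ Forces ψ D (res X h x) := by
  rw [equiv, forces_conj, forces_imp, forces_imp]
  exact ⟨fun h D k => ⟨h.1 D k, h.2 D k⟩, fun h => ⟨fun D k => (h D k).1, fun D k => (h D k).2⟩⟩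

theorem realCut_mem (C : P) (x : ℝ) : realCut C x ∈ (cuts P).obj C := by
  change Forces (isCut P) C
    (pr (pr (X := 𝟙_ _) PUnit.unit (realCut C x).1) (realCut C x).2)
  simp only [isCut, forces_conj, forces_ex, forces_all, forces_equiv, forces_mem, ltQ, forces_cstRel,
    forces_imp, forces_disj, neg, v0_app, v1_app, v2_app, v3_app, res_pr, res_res]
  have hL (D E : P) (h : C ≤ D) (k : D ≤ E) (y : (RatObj P).obj E) :
      y ∈ LocalSub.obj (res (Pow (RatObj P)) h (realCut C x).1) E k ↔ (y.down : ℝ) < x := Iff.rfl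
  have hU (D E : P) (h : C ≤ D) (k : D ≤ E) (y : (RatObj P).obj E) :
      y ∈ LocalSub.obj (res (Pow (RatObj P)) h (realCut C x).2) E k ↔ x < (y.down : ℝ) := Iff.rfl
  refine ⟨?_, ?_, ?_, ?_, ?_, ?_⟩
  · obtain ⟨q, hq⟩ := exists_rat_lt x
    exact ⟨⟨q⟩, hq⟩
  · obtain ⟨q, hq⟩ := exists_rat_gt x
    exact ⟨⟨q⟩, hq⟩
  · intro D h p E k
    simp only [hL]
    constructor
    · intro hp
      obtain ⟨q, h1, h2⟩ := exists_rat_btwn hp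
      exact ⟨⟨q⟩, by exact_mod_cast h1, h2⟩
    · rintro ⟨q, h1, h2⟩
      exact lt_trans (by exact_mod_cast h1) h2
  · intro D h p E k
    simp only [hU]
    constructor
    · intro hp
      obtain ⟨q, h1, h2⟩ := exists_rat_btwn hp
      exact ⟨⟨q⟩, by exact_mod_cast h2, h1⟩
    · rintro ⟨q, h1, h2⟩
      exact lt_trans h2 (by exact_mod_cast h1)
  · intro D h p E k hp
    simp only [hL, hU] at hp
    exact absurd (hp.1.trans hp.2) (lt_irrefl _)
  · intro D h p E k q F l hpq
    simp only [hL, hU]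
    by_contra! hc
    exact absurd (hc.2.trans hc.1) (not_le.2 (by exact_mod_cast hpq))

/-- The canonical arrow from the constant functor `ℝ` to the Dedekind real numbers. -/
def ofReal : cst P ℝ ⟶ PtReal P :=
  arrow (fun C x => ⟨realCut C x.down, realCut_mem C x.down⟩) fun _ _ _ _ => rfl

/-- The canonical arrow from the constant functor `ℂ` to the Dedekind complex numbers. -/
def ofComplex : cst P ℂ ⟶ PtComplex P :=
  lift (cst₁ Complex.re ≫ ofReal) (cst₁ Complex.im ≫ ofReal)

variable (P) in
/-- Addition, negation and multiplication on the Dedekind real numbers. -/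
structure RealArith where
  add : PtReal P ⊗ PtReal P ⟶ PtReal P
  neg : PtReal P ⟶ PtReal P
  mul : PtReal P ⊗ PtReal P ⟶ PtReal P

section Cuts

variable {Γ : P ⥤ Type u}

/-- The formula `p < x` for a rational `p` and a Dedekind real `x`. -/
def below (p : Γ ⟶ RatObj P) (x : Γ ⟶ PtReal P) : Fm Γ := mem p (x ≫ lowerCut)
/-- The formula `x < q` for a rational `q` and a Dedekind real `x`. -/
def above (q : Γ ⟶ RatObj P) (x : Γ ⟶ PtReal P) : Fm Γ := mem q (x ≫ upperCut)
def addQ (p q : Γ ⟶ RatObj P) : Γ ⟶ RatObj P := ap₂ (cst₂ (· + ·)) p q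
def mulQ (p q : Γ ⟶ RatObj P) : Γ ⟶ RatObj P := ap₂ (cst₂ (· * ·)) p q
def negQ (p : Γ ⟶ RatObj P) : Γ ⟶ RatObj P := ap₁ (cst₁ (- ·)) p

end Cuts

/-- The operations are the usual ones on Dedekind cuts (by interval arithmetic); each formula
determines the cut of the result. -/
structure RealArith.IsStandard (r : RealArith P) : Prop where
  -- for all `x y p q`: `p < x` and `q < y` imply `p + q < x + y`, and dually
  add_spec : Valid <| all (PtReal P) <| all (PtReal P) <| all (RatObj P) <| all (RatObj P) <|
    conj (imp (conj (below v1 v3) (below v0 v2)) (below (addQ v1 v0) (ap₂ r.add v3 v2)))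
      (imp (conj (above v1 v3) (above v0 v2)) (above (addQ v1 v0) (ap₂ r.add v3 v2)))
  -- for all `x p`: `p < x` implies `-x < -p`, and dually
  neg_spec : Valid <| all (PtReal P) <| all (RatObj P) <|
    conj (imp (below v0 v1) (above (negQ v0) (ap₁ r.neg v1)))
      (imp (above v0 v1) (below (negQ v0) (ap₁ r.neg v1)))
  -- for all `x y a b c d p` with `a < x < b` and `c < y < d`: if `p` is less than each of
  -- `ac`, `ad`, `bc`, `bd`, then `p < xy`, and dually
  mul_spec : Valid <| all (PtReal P) <| all (PtReal P) <|
    all (RatObj P) <| all (RatObj P) <| all (RatObj P) <| all (RatObj P) <| all (RatObj P) <|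
    imp (conj (conj (below v4 v6) (above v3 v6)) (conj (below v2 v5) (above v1 v5))) <|
    conj
      (imp (conj (conj (ltQ v0 (mulQ v4 v2)) (ltQ v0 (mulQ v4 v1)))
          (conj (ltQ v0 (mulQ v3 v2)) (ltQ v0 (mulQ v3 v1))))
        (below v0 (ap₂ r.mul v6 v5)))
      (imp (conj (conj (ltQ (mulQ v4 v2) v0) (ltQ (mulQ v4 v1) v0))
          (conj (ltQ (mulQ v3 v2) v0) (ltQ (mulQ v3 v1) v0)))
        (above v0 (ap₂ r.mul v6 v5)))

/-! ### Algebras in the topos -/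

/-- The operations on an object of scalars. -/
structure ScalarData (K : P ⥤ Type u) where
  one : 𝟙_ (P ⥤ Type u) ⟶ K
  add : K ⊗ K ⟶ K
  mul : K ⊗ K ⟶ K
  conj : K ⟶ K

variable (P) in
/-- The Gaussian numbers as scalars. -/
def gaussScalars : ScalarData (GaussObj P) where
  one := cst₀ 1
  add := cst₂ (· + ·)
  mul := cst₂ (· * ·)
  conj := cst₁ GaussRat.conj

/-- The Dedekind complex numbers as scalars, given the arithmetic of the Dedekind reals. -/
def RealArith.complexScalars (r : RealArith P) : ScalarData (PtComplex P) where
  one := cst₀ 1 ≫ ofComplex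
  add :=
    let x := fst (PtComplex P) (PtComplex P)
    let y := snd (PtComplex P) (PtComplex P)
    lift (ap₂ r.add (x ≫ fst _ _) (y ≫ fst _ _)) (ap₂ r.add (x ≫ snd _ _) (y ≫ snd _ _))
  mul :=
    let x := fst (PtComplex P) (PtComplex P)
    let y := snd (PtComplex P) (PtComplex P)
    lift
      (ap₂ r.add (ap₂ r.mul (x ≫ fst _ _) (y ≫ fst _ _))
        (ap₁ r.neg (ap₂ r.mul (x ≫ snd _ _) (y ≫ snd _ _))))
      (ap₂ r.add (ap₂ r.mul (x ≫ fst _ _) (y ≫ snd _ _))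
        (ap₂ r.mul (x ≫ snd _ _) (y ≫ fst _ _)))
  conj := lift (fst _ _) (ap₁ r.neg (snd _ _))

/-- The inclusion of the Gaussian numbers in the Dedekind complex numbers. -/
def gaussIncl : GaussObj P ⟶ PtComplex P := cst₁ (fun z => (z : ℂ)) ≫ ofComplex

/-- The operations of a unital *-algebra `A` over an object of scalars `K`. -/
structure StarAlgData (K A : P ⥤ Type u) where
  zero : 𝟙_ (P ⥤ Type u) ⟶ A
  one : 𝟙_ (P ⥤ Type u) ⟶ A
  add : A ⊗ A ⟶ A
  neg : A ⟶ A
  smul : K ⊗ A ⟶ A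
  mul : A ⊗ A ⟶ A
  star : A ⟶ A

/-- Restriction of scalars along an arrow `j`. -/
def StarAlgData.restrictScalars {K L A : P ⥤ Type u} (a : StarAlgData K A) (j : L ⟶ K) :
    StarAlgData L A where
  zero := a.zero
  one := a.one
  add := a.add
  neg := a.neg
  smul := j ▷ A ≫ a.smul
  mul := a.mul
  star := a.star

namespace StarAlgData

variable {K A : P ⥤ Type u}

/-- `A` is, internally, a unital *-algebra over `K`: a vector space with an associative bilinear
multiplication with unit, and an involution. -/
structure IsUnitalStarAlgebra (k : ScalarData K) (a : StarAlgData K A) : Prop where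
  add_assoc : Valid <| all A <| all A <| all A <|
    eq (ap₂ a.add (ap₂ a.add v2 v1) v0) (ap₂ a.add v2 (ap₂ a.add v1 v0))
  add_comm : Valid <| all A <| all A <| eq (ap₂ a.add v1 v0) (ap₂ a.add v0 v1)
  add_zero : Valid <| all A <| eq (ap₂ a.add v0 (ap₀ a.zero)) v0
  add_neg : Valid <| all A <| eq (ap₂ a.add v0 (ap₁ a.neg v0)) (ap₀ a.zero)
  one_smul : Valid <| all A <| eq (ap₂ a.smul (ap₀ k.one) v0) v0
  mul_smul : Valid <| all K <| all K <| all A <|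
    eq (ap₂ a.smul (ap₂ k.mul v2 v1) v0) (ap₂ a.smul v2 (ap₂ a.smul v1 v0))
  smul_add : Valid <| all K <| all A <| all A <|
    eq (ap₂ a.smul v2 (ap₂ a.add v1 v0)) (ap₂ a.add (ap₂ a.smul v2 v1) (ap₂ a.smul v2 v0))
  add_smul : Valid <| all K <| all K <| all A <|
    eq (ap₂ a.smul (ap₂ k.add v2 v1) v0) (ap₂ a.add (ap₂ a.smul v2 v0) (ap₂ a.smul v1 v0))
  mul_assoc : Valid <| all A <| all A <| all A <|
    eq (ap₂ a.mul (ap₂ a.mul v2 v1) v0) (ap₂ a.mul v2 (ap₂ a.mul v1 v0))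
  add_mul : Valid <| all A <| all A <| all A <|
    eq (ap₂ a.mul (ap₂ a.add v2 v1) v0) (ap₂ a.add (ap₂ a.mul v2 v0) (ap₂ a.mul v1 v0))
  mul_add : Valid <| all A <| all A <| all A <|
    eq (ap₂ a.mul v2 (ap₂ a.add v1 v0)) (ap₂ a.add (ap₂ a.mul v2 v1) (ap₂ a.mul v2 v0))
  smul_mul : Valid <| all K <| all A <| all A <|
    eq (ap₂ a.mul (ap₂ a.smul v2 v1) v0) (ap₂ a.smul v2 (ap₂ a.mul v1 v0))
  mul_smul_comm : Valid <| all K <| all A <| all A <|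
    eq (ap₂ a.mul v1 (ap₂ a.smul v2 v0)) (ap₂ a.smul v2 (ap₂ a.mul v1 v0))
  one_mul : Valid <| all A <| eq (ap₂ a.mul (ap₀ a.one) v0) v0
  mul_one : Valid <| all A <| eq (ap₂ a.mul v0 (ap₀ a.one)) v0
  star_add : Valid <| all A <| all A <|
    eq (ap₁ a.star (ap₂ a.add v1 v0)) (ap₂ a.add (ap₁ a.star v1) (ap₁ a.star v0))
  star_smul : Valid <| all K <| all A <|
    eq (ap₁ a.star (ap₂ a.smul v1 v0)) (ap₂ a.smul (ap₁ k.conj v1) (ap₁ a.star v0))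
  star_mul : Valid <| all A <| all A <|
    eq (ap₁ a.star (ap₂ a.mul v1 v0)) (ap₂ a.mul (ap₁ a.star v0) (ap₁ a.star v1))
  star_star : Valid <| all A <| eq (ap₁ a.star (ap₁ a.star v0)) v0

/-- Multiplication is, internally, commutative. -/
def IsCommutative (a : StarAlgData K A) : Prop :=
  Valid <| all A <| all A <| eq (ap₂ a.mul v1 v0) (ap₂ a.mul v0 v1)

/-- `N`, with `N(a, q)` read as `‖a‖ < q`, is internally a seminorm relation that makes the
unital *-algebra `A` over `ℂ_ℚ` a pre-semi-C*-algebra. -/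
structure IsPreSemiCStar (a : StarAlgData (GaussObj P) A) (N : Fm (A ⊗ PosRatObj P)) : Prop where
  zero_mem : Valid <| all (PosRatObj P) <| ap₂ N (ap₀ a.zero) v0
  exists_mem : Valid <| all A <| ex (PosRatObj P) <| ap₂ N v1 v0
  star_mem : Valid <| all A <| all (PosRatObj P) <|
    imp (ap₂ N v1 v0) (ap₂ N (ap₁ a.star v1) v0)
  -- `N(a, q) ↔ ∃ p < q, N(a, p)`
  rounded : Valid <| all A <| all (PosRatObj P) <|
    equiv (ap₂ N v1 v0) <|
      ex (PosRatObj P) <| conj (ap₂ (cstRel fun p q => p < q) v0 v1) (ap₂ N v2 v0)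
  -- `N(a, p) ∧ N(b, q) → N(a + b, p + q)`, in the context `a b p q`
  add_mem : Valid <| all A <| all A <| all (PosRatObj P) <| all (PosRatObj P) <|
    imp (conj (ap₂ N v3 v1) (ap₂ N v2 v0))
      (ap₂ N (ap₂ a.add v3 v2)
        (ap₂ (cst₂ fun p q : PosRat => (⟨p.1 + q.1, add_pos p.2 q.2⟩ : PosRat)) v1 v0))
  -- `N(a, p) ∧ N(b, q) → N(ab, pq)`, in the context `a b p q`
  mul_mem : Valid <| all A <| all A <| all (PosRatObj P) <| all (PosRatObj P) <|
    imp (conj (ap₂ N v3 v1) (ap₂ N v2 v0))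
      (ap₂ N (ap₂ a.mul v3 v2)
        (ap₂ (cst₂ fun p q : PosRat => (⟨p.1 * q.1, mul_pos p.2 q.2⟩ : PosRat)) v1 v0))
  -- `|z| < q ∧ N(a, p) → N(za, pq)`, in the context `z a p q`
  smul_mem : Valid <| all (GaussObj P) <| all A <| all (PosRatObj P) <| all (PosRatObj P) <|
    imp (conj (ap₂ (cstRel fun (z : GaussRat) (q : PosRat) => ‖(z : ℂ)‖ < (q.1 : ℝ)) v3 v0)
        (ap₂ N v2 v1))
      (ap₂ N (ap₂ a.smul v3 v2)
        (ap₂ (cst₂ fun p q : PosRat => (⟨p.1 * q.1, mul_pos p.2 q.2⟩ : PosRat)) v1 v0))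
  -- `N(1, p)` for `p > 1`
  one_mem : Valid <| all (PosRatObj P) <|
    imp (ap₂ (cstRel fun (r : ℚ) (p : PosRat) => r < p.1) (ap₀ (cst₀ 1)) v0)
      (ap₂ N (ap₀ a.one) v0)
  -- `N(a* a, q ^ 2) ↔ N(a, q)`
  cstar : Valid <| all A <| all (PosRatObj P) <|
    equiv
      (ap₂ N (ap₂ a.mul (ap₁ a.star v1) v1)
        (ap₁ (cst₁ fun q : PosRat => (⟨q.1 ^ 2, pow_pos q.2 2⟩ : PosRat)) v0))
      (ap₂ N v1 v0)

/-- Internally, the seminorm is a norm: `(∀ q, N(a, q)) → a = 0`. -/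
def IsNorm (a : StarAlgData K A) (N : Fm (A ⊗ PosRatObj P)) : Prop :=
  Valid <| all A <| imp (all (PosRatObj P) <| ap₂ N v1 v0) (eq v0 (ap₀ a.zero))

/-- The formula saying that `S`, the only free variable, is a Cauchy approximation: a sequence of
subobjects `S n = {x | (n, x) ∈ S}` of `A` such that `∀ n, ∃ x, x ∈ S n` and
`∀ ε, ∃ m, ∀ n n' x x', m ≤ n ∧ m ≤ n' ∧ x ∈ S n ∧ x' ∈ S n' → N(x - x', ε)`. -/
def cauchyApprox (a : StarAlgData K A) (N : Fm (A ⊗ PosRatObj P)) :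
    Fm (𝟙_ (P ⥤ Type u) ⊗ Pow (NatObj P ⊗ A)) :=
  conj
    (all (NatObj P) <| ex A <| mem (lift v1 v0) v2)
    (all (PosRatObj P) <| ex (NatObj P) <|
      all (NatObj P) <| all (NatObj P) <| all A <| all A <|
      imp
        (conj (conj (ap₂ (cstRel fun m n => m ≤ n) v4 v3) (ap₂ (cstRel fun m n => m ≤ n) v4 v2))
          (conj (mem (lift v3 v1) v6) (mem (lift v2 v0) v6)))
        (ap₂ N (ap₂ a.add v1 (ap₁ a.neg v0)) v5))

/-- The formula saying that the sequence `S` of subobjects of `A` converges to `y`, in the context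
`S y`: `∀ ε, ∃ m, ∀ n x, m ≤ n ∧ x ∈ S n → N(x - y, ε)`. -/
def convergesTo (a : StarAlgData K A) (N : Fm (A ⊗ PosRatObj P)) :
    Fm ((𝟙_ (P ⥤ Type u) ⊗ Pow (NatObj P ⊗ A)) ⊗ A) :=
  all (PosRatObj P) <| ex (NatObj P) <| all (NatObj P) <| all A <|
    imp (conj (ap₂ (cstRel fun m n => m ≤ n) v2 v1) (mem (lift v1 v0) v5))
      (ap₂ N (ap₂ a.add v0 (ap₁ a.neg v4)) v3)

/-- Internally, every Cauchy approximation converges. -/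
def IsCauchyComplete (a : StarAlgData K A) (N : Fm (A ⊗ PosRatObj P)) : Prop :=
  Valid <| all (Pow (NatObj P ⊗ A)) <| imp (a.cauchyApprox N) (ex A (a.convergesTo N))

/-- `A` with the norm relation `N` is, internally, a unital C*-algebra. -/
structure IsUnitalCStarAlgebra (a : StarAlgData (GaussObj P) A) (N : Fm (A ⊗ PosRatObj P)) :
    Prop where
  star_algebra : a.IsUnitalStarAlgebra (gaussScalars P)
  pre_semi : a.IsPreSemiCStar N
  norm : a.IsNorm N
  complete : a.IsCauchyComplete N

end StarAlgData

end FunctorTopos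

end

/-! ## The Bohrification of a C*-algebra -/

open FunctorTopos

/-- The poset of unital commutative C*-subalgebras of `A`, ordered by inclusion. -/
abbrev Context (A : Type u) [CStarAlgebra A] : Type u :=
  {C : StarSubalgebra ℂ A // IsClosed (C : Set A) ∧ ∀ x ∈ C, ∀ y ∈ C, x * y = y * x}

/-- The tautological functor `C ↦ C`, with inclusions as transition maps. -/
def bohrification (A : Type u) [CStarAlgebra A] : Context A ⥤ Type u where
  obj C := C.1
  map f := TypeCat.ofHom fun x => (⟨x.1, leOfHom f x.2⟩ : _)
  map_id _ := rfl
  map_comp _ _ := rfl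

/-! By Kripke–Joyal semantics a sentence is valid when every context forces it. Over a poset, `∧`,
`∨`, `∃` and equality are decided at the current stage; only `→` and `∀` look at later stages `D ≥
C`. The `forces_*` lemmas thus turn each internal axiom into an ordinary statement about the
algebras `C`, their inclusions and external numbers.

Internal numbers: `ℚ` is constant, so an internal cut restricts at each stage `D ≥ C` to an ordinary
Dedekind cut and gives a real `x_D`. Lower and upper sets both grow along `C ≤ D`, which forces `x_C
≤ x_D` and `x_D ≤ x_C`. A cut is therefore one external real (`ofReal_surjective`), and `ofReal` and
`ofComplex` are isomorphisms. Arithmetic is transported along them.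

Algebra and norm: inclusions of contexts preserve all operations and the norm. Equational axioms
reduce to identities in each *-algebra `C`, and norm axioms to inequalities for its norm together
with density of `ℚ` in `ℝ`.

Completeness is the substantial axiom (`bohrificationAlg_isCauchyComplete`). A Cauchy approximation
at `C` is inhabited at `C` itself, so external choice yields a Cauchy sequence in `C`, which
converges because `C` is closed in `A`. The Cauchy condition also covers members appearing at later
stages, so they too approach this limit. -/

namespace FunctorTopos

section

variable {P : Type u} [Preorder P]

/-! ### Evaluation of terms and atomic formulas at a stage -/

section Terms

variable {Γ Y Z W : P ⥤ Type u} (C : P) (x : Γ.obj C)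

theorem ap₀_app (f : 𝟙_ (P ⥤ Type u) ⟶ Y) :
    (ap₀ f : Γ ⟶ Y).app C x = f.app C PUnit.unit := rfl

theorem ap₁_app (f : Y ⟶ Z) (s : Γ ⟶ Y) : (ap₁ f s).app C x = f.app C (s.app C x) := rfl

theorem ap₂_app (f : Y ⊗ Z ⟶ W) (s : Γ ⟶ Y) (t : Γ ⟶ Z) :
    (ap₂ f s t).app C x = f.app C (pr (s.app C x) (t.app C x)) := rfl

theorem lift_app (s : Γ ⟶ Y) (t : Γ ⟶ Z) : (lift s t).app C x = pr (s.app C x) (t.app C x) := rfl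

theorem comp_app (s : Γ ⟶ Y) (f : Y ⟶ Z) : (s ≫ f).app C x = f.app C (s.app C x) := rfl

theorem forces_ap₂ (φ : Fm (Y ⊗ Z)) (s : Γ ⟶ Y) (t : Γ ⟶ Z) :
    Forces (ap₂ φ s t) C x ↔ Forces φ C (pr (s.app C x) (t.app C x)) := Iff.rfl

theorem forces_cstRel_pr {α β : Type} (r : α → β → Prop) (a : (cst P α).obj C)
    (b : (cst P β).obj C) : Forces (cstRel r) C (pr a b) ↔ r a.down b.down :=
  forces_char _ C (pr a b)

end Terms

/-! ### The Dedekind real numbers are the constant functor `ℝ` -/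

theorem res_ofReal {C D : P} (h : C ≤ D) (x : ℝ) :
    res (PtReal P) h (ofReal.app C ⟨x⟩) = ofReal.app D ⟨x⟩ := rfl

theorem mem_lowerCut_ofReal {C : P} (x : ℝ) (p : (RatObj P).obj C) :
    p ∈ LocalSub.obj (lowerCut.app C (ofReal.app C ⟨x⟩)) C le_rfl ↔ (p.down : ℝ) < x := Iff.rfl

theorem mem_upperCut_ofReal {C : P} (x : ℝ) (p : (RatObj P).obj C) :
    p ∈ LocalSub.obj (upperCut.app C (ofReal.app C ⟨x⟩)) C le_rfl ↔ x < (p.down : ℝ) := Iff.rfl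

theorem ofReal_injective (C : P) : Function.Injective (ofReal.app C) := by
  rintro ⟨x⟩ ⟨y⟩ h
  have key (q : ℚ) : (q : ℝ) < x ↔ (q : ℝ) < y := by
    rw [← mem_lowerCut_ofReal (C := C) x ⟨q⟩, h, mem_lowerCut_ofReal]
  congr 1
  refine le_antisymm (le_of_forall_rat_lt_imp_le fun q hq => ((key q).1 hq).le)
    (le_of_forall_rat_lt_imp_le fun q hq => ((key q).2 hq).le)

/-- A Dedekind cut of the rationals determines a real number. -/
theorem exists_real_of_cut {L U : Set ℚ} (hL : L.Nonempty) (hU : U.Nonempty)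
    (hLo : ∀ p, p ∈ L ↔ ∃ q, p < q ∧ q ∈ L) (hUo : ∀ p, p ∈ U ↔ ∃ q, q < p ∧ q ∈ U)
    (hd : ∀ p, ¬ (p ∈ L ∧ p ∈ U)) (hl : ∀ p q, p < q → p ∈ L ∨ q ∈ U) :
    ∃ x : ℝ, (∀ p : ℚ, p ∈ L ↔ (p : ℝ) < x) ∧ ∀ p : ℚ, p ∈ U ↔ x < (p : ℝ) := by
  -- Roundedness makes `L` downward closed, so `q ≤ p` would put `q` in both `L` and `U`.
  have hlt : ∀ p ∈ L, ∀ q ∈ U, p < q := by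
    intro p hp q hq
    by_contra! h
    rcases h.eq_or_lt with rfl | h
    · exact hd _ ⟨hp, hq⟩
    · exact hd q ⟨(hLo q).2 ⟨p, h, hp⟩, hq⟩
  obtain ⟨u, hu⟩ := hU
  set S : Set ℝ := (fun q : ℚ => (q : ℝ)) '' L
  have hbdd : BddAbove S := ⟨u, by rintro _ ⟨p, hp, rfl⟩; exact Rat.cast_le.2 (hlt p hp u hu).le⟩
  -- The real number is the supremum of `L`; since `L` has no largest element, the inequality is
  -- strict.
  have hL' (p : ℚ) : p ∈ L ↔ (p : ℝ) < sSup S := by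
    constructor
    · intro hp
      obtain ⟨q, hpq, hq⟩ := (hLo p).1 hp
      exact lt_of_lt_of_le (Rat.cast_lt.2 hpq) (le_csSup hbdd ⟨q, hq, rfl⟩)
    · intro hp
      obtain ⟨_, ⟨q, hq, rfl⟩, hpq⟩ := exists_lt_of_lt_csSup (hL.image _) hp
      exact (hLo p).2 ⟨q, Rat.cast_lt.1 hpq, hq⟩
  refine ⟨sSup S, hL', fun p => ⟨fun hp => ?_, fun hp => ?_⟩⟩
  · obtain ⟨q, hqp, hq⟩ := (hUo p).1 hp
    refine lt_of_le_of_lt (csSup_le (hL.image _) ?_) (Rat.cast_lt.2 hqp)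
    rintro _ ⟨l, hl', rfl⟩
    exact Rat.cast_le.2 (hlt l hl' q hq).le
  · obtain ⟨q, h1, h2⟩ := exists_rat_btwn hp
    refine (hl q p (by exact_mod_cast h2)).resolve_left fun hq => ?_
    exact absurd ((hL' q).1 hq) h1.not_gt

/-- Forcing persists to `D`, and there every quantifier over the constant object `ℚ` can be
instantiated at `D` itself, so the sections over `D` form an external cut. The real found may a
priori depend on `D`. -/
theorem exists_real_of_mem_cuts {C : P} {s : (Pow (RatObj P) ⊗ Pow (RatObj P)).obj C}
    (hs : s ∈ (cuts P).obj C) (D : P) (h : C ≤ D) :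
    ∃ x : ℝ, (∀ p : ℚ, ⟨p⟩ ∈ LocalSub.obj s.1 D h ↔ (p : ℝ) < x) ∧
      ∀ p : ℚ, ⟨p⟩ ∈ LocalSub.obj s.2 D h ↔ x < (p : ℝ) := by
  replace hs : Forces (isCut P) D
    (pr (pr (X := 𝟙_ _) PUnit.unit (res _ h s.1)) (res _ h s.2)) :=
    Forces.mono (φ := isCut P) (x := pr (pr (X := 𝟙_ _) PUnit.unit s.1) s.2) hs h
  simp only [isCut, forces_conj, forces_ex, forces_all, forces_equiv, forces_mem, ltQ,
    forces_cstRel, forces_imp, forces_disj, neg, v0_app, v1_app, v2_app, v3_app, res_pr, res_res,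
    forces_fls, imp_false] at hs
  obtain ⟨⟨l, hl⟩, ⟨m, hm⟩, hLo, hUo, hd, hloc⟩ := hs
  refine exists_real_of_cut (L := {p | (⟨p⟩ : (RatObj P).obj D) ∈ LocalSub.obj s.1 D h})
    (U := {p | (⟨p⟩ : (RatObj P).obj D) ∈ LocalSub.obj s.2 D h}) ⟨l.down, hl⟩ ⟨m.down, hm⟩ ?_ ?_ ?_ ?_
  · intro p
    refine (hLo D le_rfl ⟨p⟩ D le_rfl).trans ⟨?_, ?_⟩
    · rintro ⟨q, hq⟩; exact ⟨q.down, hq⟩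
    · rintro ⟨q, hq⟩; exact ⟨⟨q⟩, hq⟩
  · intro p
    refine (hUo D le_rfl ⟨p⟩ D le_rfl).trans ⟨?_, ?_⟩
    · rintro ⟨q, hq⟩; exact ⟨q.down, hq⟩
    · rintro ⟨q, hq⟩; exact ⟨⟨q⟩, hq⟩
  · exact fun p hp => hd D le_rfl ⟨p⟩ D le_rfl hp
  · exact fun p q hpq => hloc D le_rfl ⟨p⟩ D le_rfl ⟨q⟩ D le_rfl hpq

/-- The reals cut out at different stages agree: growth of the lower sets makes them increase along
`C ≤ D`, and growth of the upper sets makes them decrease. -/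
theorem ofReal_surjective (C : P) : Function.Surjective (ofReal.app C) := by
  rintro ⟨s, hs⟩
  obtain ⟨x, hx⟩ := exists_real_of_mem_cuts hs C le_rfl
  have key (D : P) (h : C ≤ D) : (∀ p : ℚ, ⟨p⟩ ∈ LocalSub.obj s.1 D h ↔ (p : ℝ) < x) ∧
      ∀ p : ℚ, ⟨p⟩ ∈ LocalSub.obj s.2 D h ↔ x < (p : ℝ) := by
    obtain ⟨y, hy⟩ := exists_real_of_mem_cuts hs D h
    have hxy : x = y := by
      refine le_antisymm (le_of_forall_rat_lt_imp_le fun q hq => ?_)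
        (le_of_forall_lt_rat_imp_le fun q hq => ?_)
      · exact ((hy.1 q).1 (LocalSub.map s.1 C D le_rfl h ⟨q⟩ ((hx.1 q).2 hq))).le
      · exact ((hy.2 q).1 (LocalSub.map s.2 C D le_rfl h ⟨q⟩ ((hx.2 q).2 hq))).le
    rwa [hxy]
  refine ⟨⟨x⟩, Subtype.ext (Prod.ext ?_ ?_)⟩
  · refine LocalSub.ext (funext fun D => funext fun h => Set.ext fun p => ?_)
    exact ((key D h).1 p.down).symm
  · refine LocalSub.ext (funext fun D => funext fun h => Set.ext fun p => ?_)
    exact ((key D h).2 p.down).symm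

instance isIso_ofReal : IsIso (ofReal (P := P)) := by
  rw [NatTrans.isIso_iff_isIso_app]
  exact fun C => (isIso_iff_bijective _).2 ⟨ofReal_injective C, ofReal_surjective C⟩

theorem ofComplex_app (C : P) (z : ℂ) :
    ofComplex.app C ⟨z⟩ = pr (ofReal.app C ⟨z.re⟩) (ofReal.app C ⟨z.im⟩) := rfl

theorem ofComplex_injective (C : P) : Function.Injective (ofComplex.app C) := by
  rintro ⟨z⟩ ⟨w⟩ h
  rw [ofComplex_app, ofComplex_app] at h
  have h1 := ofReal_injective C (congrArg Prod.fst h)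
  have h2 := ofReal_injective C (congrArg Prod.snd h)
  exact congrArg ULift.up (Complex.ext (congrArg ULift.down h1) (congrArg ULift.down h2))

theorem ofComplex_surjective (C : P) : Function.Surjective (ofComplex.app C) := by
  rintro ⟨x, y⟩
  obtain ⟨⟨a⟩, rfl⟩ := ofReal_surjective C x
  obtain ⟨⟨b⟩, rfl⟩ := ofReal_surjective C y
  exact ⟨⟨⟨a, b⟩⟩, rfl⟩

instance isIso_ofComplex : IsIso (ofComplex (P := P)) := by
  rw [NatTrans.isIso_iff_isIso_app]
  exact fun C => (isIso_iff_bijective _).2 ⟨ofComplex_injective C, ofComplex_surjective C⟩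

theorem exists_ofComplex {C : P} (x : (PtComplex P).obj C) : ∃ z : ℂ, x = ofComplex.app C ⟨z⟩ := by
  obtain ⟨⟨z⟩, rfl⟩ := ofComplex_surjective C x
  exact ⟨z, rfl⟩

theorem exists_ofReal {C : P} (x : (PtReal P).obj C) : ∃ a : ℝ, x = ofReal.app C ⟨a⟩ := by
  obtain ⟨⟨z⟩, rfl⟩ := ofReal_surjective C x
  exact ⟨z, rfl⟩

theorem inv_ofReal_app (C : P) (x : ℝ) : (inv ofReal).app C (ofReal.app C ⟨x⟩) = ⟨x⟩ :=
  ConcreteCategory.congr_hom (NatTrans.congr_app (IsIso.hom_inv_id (ofReal (P := P))) C) ⟨x⟩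

theorem inv_ofComplex_app (C : P) (z : ℂ) : (inv ofComplex).app C (ofComplex.app C ⟨z⟩) = ⟨z⟩ :=
  ConcreteCategory.congr_hom (NatTrans.congr_app (IsIso.hom_inv_id (ofComplex (P := P))) C) ⟨z⟩

/-! ### Arithmetic of the Dedekind real numbers -/

variable (P) in
/-- The arithmetic of the real numbers, transported along `ofReal`. -/
noncomputable def realArith : RealArith P where
  add := (inv ofReal ⊗ₘ inv ofReal) ≫ cst₂ (· + ·) ≫ ofReal
  neg := inv ofReal ≫ cst₁ (- ·) ≫ ofReal
  mul := (inv ofReal ⊗ₘ inv ofReal) ≫ cst₂ (· * ·) ≫ ofReal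

theorem realArith_add (C : P) (x y : ℝ) :
    (realArith P).add.app C (pr (ofReal.app C ⟨x⟩) (ofReal.app C ⟨y⟩)) =
      ofReal.app C ⟨x + y⟩ := by
  change ofReal.app C ⟨((inv ofReal).app C (ofReal.app C ⟨x⟩)).down +
    ((inv ofReal).app C (ofReal.app C ⟨y⟩)).down⟩ = _
  rw [inv_ofReal_app, inv_ofReal_app]

theorem realArith_mul (C : P) (x y : ℝ) :
    (realArith P).mul.app C (pr (ofReal.app C ⟨x⟩) (ofReal.app C ⟨y⟩)) =
      ofReal.app C ⟨x * y⟩ := by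
  change ofReal.app C ⟨((inv ofReal).app C (ofReal.app C ⟨x⟩)).down *
    ((inv ofReal).app C (ofReal.app C ⟨y⟩)).down⟩ = _
  rw [inv_ofReal_app, inv_ofReal_app]

theorem realArith_neg (C : P) (x : ℝ) :
    (realArith P).neg.app C (ofReal.app C ⟨x⟩) = ofReal.app C ⟨-x⟩ := by
  change ofReal.app C ⟨-((inv ofReal).app C (ofReal.app C ⟨x⟩)).down⟩ = _
  rw [inv_ofReal_app]

theorem complexScalars_add (C : P) (z w : ℂ) :
    (realArith P).complexScalars.add.app C (pr (ofComplex.app C ⟨z⟩) (ofComplex.app C ⟨w⟩)) =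
      ofComplex.app C ⟨z + w⟩ :=
  Prod.ext (realArith_add C z.re w.re) (realArith_add C z.im w.im)

theorem complexScalars_mul (C : P) (z w : ℂ) :
    (realArith P).complexScalars.mul.app C (pr (ofComplex.app C ⟨z⟩) (ofComplex.app C ⟨w⟩)) =
      ofComplex.app C ⟨z * w⟩ := by
  change pr
    ((realArith P).add.app C (pr
      ((realArith P).mul.app C (pr (ofReal.app C ⟨z.re⟩) (ofReal.app C ⟨w.re⟩)))
      ((realArith P).neg.app C
        ((realArith P).mul.app C (pr (ofReal.app C ⟨z.im⟩) (ofReal.app C ⟨w.im⟩))))))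
    ((realArith P).add.app C (pr
      ((realArith P).mul.app C (pr (ofReal.app C ⟨z.re⟩) (ofReal.app C ⟨w.im⟩)))
      ((realArith P).mul.app C (pr (ofReal.app C ⟨z.im⟩) (ofReal.app C ⟨w.re⟩))))) = _
  simp only [realArith_add, realArith_mul, realArith_neg, ofComplex_app, Complex.mul_re,
    Complex.mul_im, sub_eq_add_neg]

theorem complexScalars_conj (C : P) (z : ℂ) :
    (realArith P).complexScalars.conj.app C (ofComplex.app C ⟨z⟩) =
      ofComplex.app C ⟨starRingEnd ℂ z⟩ :=
  Prod.ext rfl (realArith_neg C z.im)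

theorem complexScalars_one (C : P) :
    (realArith P).complexScalars.one.app C PUnit.unit = ofComplex.app C ⟨1⟩ := rfl

/-- A product of reals lies in the interval spanned by the products of bounds. -/
theorem lt_mul_of_bounds {x y a b c d p : ℝ} (ha : a < x) (hb : x < b) (hc : c < y) (hd : y < d)
    (hac : p < a * c) (had : p < a * d) (hbc : p < b * c) (hbd : p < b * d) : p < x * y := by
  have h1 : min (a * c) (b * c) ≤ x * c := by
    rcases le_total 0 c with h | h
    · exact (min_le_left _ _).trans (mul_le_mul_of_nonneg_right ha.le h)
    · exact (min_le_right _ _).trans (mul_le_mul_of_nonpos_right hb.le h)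
  have h2 : min (a * d) (b * d) ≤ x * d := by
    rcases le_total 0 d with h | h
    · exact (min_le_left _ _).trans (mul_le_mul_of_nonneg_right ha.le h)
    · exact (min_le_right _ _).trans (mul_le_mul_of_nonpos_right hb.le h)
  have h3 : min (x * c) (x * d) ≤ x * y := by
    rcases le_total 0 x with h | h
    · exact (min_le_left _ _).trans (mul_le_mul_of_nonneg_left hc.le h)
    · exact (min_le_right _ _).trans (mul_le_mul_of_nonpos_left hd.le h)
  exact (lt_min ((lt_min hac hbc).trans_le h1) ((lt_min had hbd).trans_le h2)).trans_le h3

/-- Apply the lower bound to `-x`, which lies between `-b` and `-a`. -/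
theorem mul_lt_of_bounds {x y a b c d p : ℝ} (ha : a < x) (hb : x < b) (hc : c < y) (hd : y < d)
    (hac : a * c < p) (had : a * d < p) (hbc : b * c < p) (hbd : b * d < p) : x * y < p := by
  have := lt_mul_of_bounds (p := -p) (neg_lt_neg hb) (neg_lt_neg ha) hc hd
    (by linarith) (by linarith) (by linarith) (by linarith)
  linarith

/-- Once every internal real is written as `ofReal` of an external one, the stages play no role and
each clause is an inequality between real numbers. -/
theorem realArith_isStandard : (realArith P).IsStandard where
  add_spec := by
    simp only [valid_iff, forces_all, forces_conj, forces_imp, below, above, forces_mem, res_pr,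
      res_res]
    intro C₀ _ C₁ _ x C₂ _ y C₃ _ p C h q
    obtain ⟨x, rfl⟩ := exists_ofReal x
    obtain ⟨y, rfl⟩ := exists_ofReal y
    simp only [comp_app, ap₂_app, v0_app, v1_app, v2_app, v3_app, res_ofReal, realArith_add,
      mem_lowerCut_ofReal, mem_upperCut_ofReal, addQ]
    constructor
    · rintro D k ⟨h1, h2⟩
      change ((p.down + q.down : ℚ) : ℝ) < _
      push_cast
      exact add_lt_add h1 h2
    · rintro D k ⟨h1, h2⟩
      change _ < ((p.down + q.down : ℚ) : ℝ)
      push_cast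
      exact add_lt_add h1 h2
  neg_spec := by
    simp only [valid_iff, forces_all, forces_conj, forces_imp, below, above, forces_mem, res_pr,
      res_res]
    intro C₀ _ C₁ _ x C h q
    obtain ⟨x, rfl⟩ := exists_ofReal x
    simp only [comp_app, ap₁_app, v0_app, v1_app, res_ofReal, realArith_neg,
      mem_lowerCut_ofReal, mem_upperCut_ofReal, negQ]
    constructor
    · intro D k h1
      change _ < ((-q.down : ℚ) : ℝ)
      push_cast
      exact neg_lt_neg h1
    · intro D k h1
      change ((-q.down : ℚ) : ℝ) < _
      push_cast
      exact neg_lt_neg h1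
  mul_spec := by
    simp only [valid_iff, forces_all, forces_conj, forces_imp, below, above, forces_mem, res_pr,
      res_res, ltQ, forces_cstRel]
    intro C₀ _ C₁ _ x C₂ _ y C₃ _ a C₄ _ b C₅ _ c C₆ _ d C₇ _ p
    obtain ⟨x, rfl⟩ := exists_ofReal x
    obtain ⟨y, rfl⟩ := exists_ofReal y
    simp only [comp_app, ap₂_app, v0_app, v1_app, v2_app, v3_app, v4_app, v5_app, v6_app,
      res_ofReal, realArith_mul, mem_lowerCut_ofReal, mem_upperCut_ofReal, mulQ]
    rintro D k ⟨⟨ha, hb⟩, hc, hd⟩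
    constructor
    · rintro E l ⟨⟨hac, had⟩, hbc, hbd⟩
      change p.down < a.down * c.down at hac
      change p.down < a.down * d.down at had
      change p.down < b.down * c.down at hbc
      change p.down < b.down * d.down at hbd
      refine lt_mul_of_bounds ha hb hc hd ?_ ?_ ?_ ?_ <;> exact_mod_cast ‹_›
    · rintro E l ⟨⟨hac, had⟩, hbc, hbd⟩
      change a.down * c.down < p.down at hac
      change a.down * d.down < p.down at had
      change b.down * c.down < p.down at hbc
      change b.down * d.down < p.down at hbd
      refine mul_lt_of_bounds ha hb hc hd ?_ ?_ ?_ ?_ <;> exact_mod_cast ‹_›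

end

end FunctorTopos

/-! ### The tautological functor as an internal C*-algebra -/

section Bohrification

variable {A : Type u} [CStarAlgebra A] {K : Context A ⥤ Type u}

/-- The operations on the tautological functor inherited from `A`, where scalars act through their
values `v` in the constant functor `ℂ`. -/
def bohrificationAlg (v : K ⟶ cst (Context A) ℂ) : StarAlgData K (bohrification A) where
  zero := arrow (fun C _ => (0 : C.1)) fun _ _ _ _ => rfl
  one := arrow (fun C _ => (1 : C.1)) fun _ _ _ _ => rfl
  add := arrow (fun C x => HAdd.hAdd (α := C.1) (β := C.1) x.1 x.2) fun _ _ _ _ => rfl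
  neg := arrow (fun C (x : C.1) => -x) fun _ _ _ _ => rfl
  smul := v ▷ bohrification A ≫ arrow (X := cst (Context A) ℂ ⊗ bohrification A)
    (fun C x => HSMul.hSMul (α := ℂ) (β := C.1) x.1.down x.2) fun _ _ _ _ => rfl
  mul := arrow (fun C x => HMul.hMul (α := C.1) (β := C.1) x.1 x.2) fun _ _ _ _ => rfl
  star := arrow (fun C x => Star.star (R := C.1) x) fun _ _ _ _ => rfl

variable (A) in
/-- The norm relation `‖a‖ < q` on the tautological functor. -/
def bohrificationNorm : Fm (bohrification A ⊗ PosRatObj (Context A)) := char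
  { obj := fun C => {x | Norm.norm (E := C.1) x.1 < (x.2.down.1 : ℝ)}
    map := fun _ _ h => h }

theorem forces_bohrificationNorm (C : Context A) (x : (bohrification A).obj C)
    (q : (PosRatObj (Context A)).obj C) :
    Forces (bohrificationNorm A) C (pr x q) ↔ Norm.norm (E := C.1) x < (q.down.1 : ℝ) :=
  forces_char _ C (pr x q)

theorem bohrificationAlg_smul (C : Context A) (z : ℂ) (x : C.1) :
    (bohrificationAlg (inv ofComplex)).smul.app C (pr (ofComplex.app C ⟨z⟩) x) = z • x := by
  change ((((inv ofComplex).app C (ofComplex.app C ⟨z⟩)).down • x : C.1)) = _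
  rw [inv_ofComplex_app]

theorem bohrificationAlg_restrictScalars {L : Context A ⥤ Type u} (v : K ⟶ cst (Context A) ℂ)
    (j : L ⟶ K) : (bohrificationAlg v).restrictScalars j = bohrificationAlg (j ≫ v) := rfl

/-- The inverse of `ofComplex` cancels, so Gaussian numbers act through their plain inclusion in
`ℂ`. -/
theorem bohrificationAlg_restrictScalars_gaussIncl :
    (bohrificationAlg (A := A) (inv ofComplex)).restrictScalars gaussIncl =
      bohrificationAlg (cst₁ fun z : GaussRat => (z : ℂ)) := by
  rw [bohrificationAlg_restrictScalars, gaussIncl, Category.assoc, IsIso.hom_inv_id,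
    Category.comp_id]

/-- Treats both kinds of scalars at once. Internal equations hold as soon as they hold in every `C`;
the hypotheses on `v` serve only the four axioms that mention operations of `K`. -/
theorem bohrificationAlg_isUnitalStarAlgebra (k : ScalarData K) (v : K ⟶ cst (Context A) ℂ)
    (h_one : ∀ C, (v.app C (k.one.app C PUnit.unit)).down = 1)
    (h_add : ∀ C z w,
      (v.app C (k.add.app C (pr z w))).down = (v.app C z).down + (v.app C w).down)
    (h_mul : ∀ C z w,
      (v.app C (k.mul.app C (pr z w))).down = (v.app C z).down * (v.app C w).down)
    (h_conj : ∀ C z, (v.app C (k.conj.app C z)).down = starRingEnd ℂ (v.app C z).down) :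
    (bohrificationAlg v).IsUnitalStarAlgebra k := by
  constructor <;>
    simp only [valid_iff, forces_all, forces_eq, res_pr, ap₀_app, ap₁_app, ap₂_app, v0_app, v1_app,
      v2_app]
  · intro _ _ _ _ _ _ _ _ C _ _
    exact add_assoc (G := C.1) _ _ _
  · intro _ _ _ _ _ C _ _
    exact add_comm (G := C.1) _ _
  · intro _ _ C _ _
    exact add_zero (M := C.1) _
  · intro _ _ C _ _
    exact add_neg_cancel (G := C.1) _
  · intro _ _ C _ x
    exact (congrArg (fun t : ℂ => HSMul.hSMul (β := C.1) t x) (h_one C)).trans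
      (one_smul ℂ (α := C.1) _)
  · intro _ _ _ _ _ _ _ _ C _ x
    exact (congrArg (fun t : ℂ => HSMul.hSMul (β := C.1) t x) (h_mul C _ _)).trans
      (mul_smul (β := C.1) _ _ _)
  · intro _ _ _ _ _ _ _ _ C _ _
    exact smul_add (A := C.1) _ _ _
  · intro _ _ _ _ _ _ _ _ C _ x
    exact (congrArg (fun t : ℂ => HSMul.hSMul (β := C.1) t x) (h_add C _ _)).trans
      (add_smul (M := C.1) _ _ _)
  · intro _ _ _ _ _ _ _ _ C _ _
    exact mul_assoc (G := C.1) _ _ _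
  · intro _ _ _ _ _ _ _ _ C _ _
    exact add_mul (R := C.1) _ _ _
  · intro _ _ _ _ _ _ _ _ C _ _
    exact mul_add (R := C.1) _ _ _
  · intro _ _ _ _ _ _ _ _ C _ _
    exact smul_mul_assoc (β := C.1) _ _ _
  · intro _ _ _ _ _ _ _ _ C _ _
    exact mul_smul_comm (β := C.1) _ _ _
  · intro _ _ C _ _
    exact one_mul (M := C.1) _
  · intro _ _ C _ _
    exact mul_one (M := C.1) _
  · intro _ _ _ _ _ C _ _
    exact star_add (R := C.1) _ _
  · intro _ _ _ _ _ C _ x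
    exact (star_smul (A := C.1) _ _).trans
      (congrArg (fun t : ℂ => HSMul.hSMul (β := C.1) t (Star.star (R := C.1) x))
        (h_conj C _).symm)
  · intro _ _ _ _ _ C _ _
    exact star_mul (R := C.1) _ _
  · intro _ _ C _ _
    exact star_star (R := C.1) _

/-- This is where commutativity of the contexts is needed; `A` itself may be noncommutative. -/
theorem bohrificationAlg_isCommutative (v : K ⟶ cst (Context A) ℂ) :
    (bohrificationAlg v).IsCommutative := by
  simp only [StarAlgData.IsCommutative, valid_iff, forces_all, forces_eq, res_pr, ap₂_app, v0_app,
    v1_app]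
  intro _ _ _ _ x C _ y
  exact Subtype.ext (C.2.2 _ (Subtype.property (p := (· ∈ C.1)) _) _
    (Subtype.property (p := (· ∈ C.1)) _))

theorem bohrificationAlg_isUnitalStarAlgebra_complex :
    (bohrificationAlg (A := A) (inv ofComplex)).IsUnitalStarAlgebra
      (realArith (Context A)).complexScalars := by
  refine bohrificationAlg_isUnitalStarAlgebra _ _ ?_ ?_ ?_ ?_
  · intro C
    rw [complexScalars_one, inv_ofComplex_app]
  · intro C z w
    obtain ⟨z, rfl⟩ := exists_ofComplex z
    obtain ⟨w, rfl⟩ := exists_ofComplex w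
    simp only [complexScalars_add, inv_ofComplex_app]
  · intro C z w
    obtain ⟨z, rfl⟩ := exists_ofComplex z
    obtain ⟨w, rfl⟩ := exists_ofComplex w
    simp only [complexScalars_mul, inv_ofComplex_app]
  · intro C z
    obtain ⟨z, rfl⟩ := exists_ofComplex z
    simp only [complexScalars_conj, inv_ofComplex_app]

theorem bohrificationAlg_isUnitalStarAlgebra_gauss :
    (bohrificationAlg (A := A) (cst₁ fun z : GaussRat => (z : ℂ))).IsUnitalStarAlgebra
      (gaussScalars (Context A)) :=
  bohrificationAlg_isUnitalStarAlgebra _ _ (fun _ => rfl) (fun _ _ _ => rfl) (fun _ _ _ => rfl)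
    (fun _ _ => rfl)

theorem bohrificationAlg_isPreSemiCStar :
    (bohrificationAlg (A := A) (cst₁ fun z : GaussRat => (z : ℂ))).IsPreSemiCStar
      (bohrificationNorm A) := by
  constructor <;>
    simp only [valid_iff, forces_all, forces_ex, forces_imp, forces_conj, forces_equiv,
      forces_cstRel_pr, forces_ap₂, forces_bohrificationNorm, res_pr, ap₀_app, ap₁_app, ap₂_app,
      v0_app, v1_app, v2_app, v3_app]
  · intro _ _ C _ q
    exact (norm_zero (E := C.1)).trans_lt (Rat.cast_pos.2 q.down.2)
  · intro _ _ C _ x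
    obtain ⟨q, hq⟩ := exists_rat_gt (Norm.norm (E := C.1) x)
    exact ⟨⟨⟨q, Rat.cast_pos.1 ((norm_nonneg (E := C.1) x).trans_lt hq)⟩⟩, hq⟩
  · intro _ _ _ _ x _ _ q C _ h
    exact (norm_star (E := C.1) _).trans_lt h
  · intro _ _ _ _ x _ _ q C _
    constructor
    · intro h
      obtain ⟨p, h1, h2⟩ := exists_rat_btwn h
      exact ⟨⟨⟨p, Rat.cast_pos.1 ((norm_nonneg (E := C.1) _).trans_lt h1)⟩⟩,
        Rat.cast_lt.1 h2, h1⟩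
    · rintro ⟨p, h1, h2⟩
      exact h2.trans (Rat.cast_lt.2 h1)
  · rintro _ _ _ _ x _ _ y _ _ p _ _ q C _ ⟨h1, h2⟩
    refine (norm_add_le (E := C.1) _ _).trans_lt ((add_lt_add h1 h2).trans_eq ?_)
    exact (Rat.cast_add _ _).symm
  · rintro _ _ _ _ x _ _ y _ _ p _ _ q C _ ⟨h1, h2⟩
    refine (norm_mul_le (α := C.1) _ _).trans_lt ((mul_lt_mul'' h1 h2 (norm_nonneg (E := C.1) _)
      (norm_nonneg (E := C.1) _)).trans_eq ?_)
    exact (Rat.cast_mul _ _).symm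
  · rintro _ _ _ _ z _ _ x _ _ p _ _ q C _ ⟨h1, h2⟩
    refine (norm_smul_le (β := C.1) _ _).trans_lt ((mul_lt_mul'' h1 h2 (norm_nonneg _)
      (norm_nonneg (E := C.1) _)).trans_eq ?_)
    -- The norm estimate gives the bound as `q * p`, while the axiom asks for `p * q`.
    exact (mul_comm _ _).trans (Rat.cast_mul _ _).symm
  · intro _ _ _ _ p C _ h
    have h' : (1 : ℝ) < (p.down.1 : ℝ) := by exact_mod_cast (show (1 : ℚ) < p.down.1 from h)
    -- Only an inequality, because `A` may be the zero algebra, where `‖1‖ = 0`.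
    have h1 : ‖(1 : A)‖ ≤ 1 := by
      rcases subsingleton_or_nontrivial A with _ | _
      · simp [Subsingleton.elim (1 : A) 0]
      · exact CStarRing.norm_one.le
    exact h1.trans_lt h'
  · intro _ _ _ _ x _ _ q C _
    have hq : (0 : ℝ) < (q.down.1 : ℝ) := Rat.cast_pos.2 q.down.2
    have key (y : C.1) : ‖Star.star y * y‖ < ((q.down.1 ^ 2 : ℚ) : ℝ) ↔ ‖y‖ < (q.down.1 : ℝ) := by
      rw [CStarRing.norm_star_mul_self, Rat.cast_pow, ← sq]
      exact pow_lt_pow_iff_left₀ (norm_nonneg _) hq.le two_ne_zero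
    exact key _

theorem bohrificationAlg_isNorm (v : K ⟶ cst (Context A) ℂ) :
    (bohrificationAlg v).IsNorm (bohrificationNorm A) := by
  simp only [StarAlgData.IsNorm, valid_iff, forces_all, forces_imp, forces_eq, forces_ap₂,
    forces_bohrificationNorm, res_pr, ap₀_app, v0_app, v1_app]
  intro _ _ _ _ x C _ h
  refine (norm_le_zero_iff (E := C.1)).1 (le_of_forall_gt_imp_ge_of_dense fun ε hε => ?_)
  obtain ⟨q, h1, h2⟩ := exists_rat_btwn hε
  exact (h C le_rfl ⟨⟨q, Rat.cast_pos.1 h1⟩⟩).le.trans h2.le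

/-- The limit is found at the stage `C` where the approximation is given. Comparing a member from a
later stage `E` with the sequence chosen in `C`, included in `E`, shows that the same limit works
there. -/
theorem bohrificationAlg_isCauchyComplete (v : K ⟶ cst (Context A) ℂ) :
    (bohrificationAlg v).IsCauchyComplete (bohrificationNorm A) := by
  simp only [StarAlgData.IsCauchyComplete, StarAlgData.cauchyApprox, StarAlgData.convergesTo,
    valid_iff, forces_all, forces_imp, forces_conj, forces_ex, forces_ap₂, forces_cstRel_pr,
    forces_mem, forces_bohrificationNorm, res_pr, ap₁_app, ap₂_app, lift_app, v0_app, v1_app,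
    v2_app, v3_app, v4_app, v5_app, v6_app, res_res]
  rintro _ _ _ h₀ S C h ⟨h_inh, h_cauchy⟩
  -- The modulus `m` is chosen at `C` and stays valid at all later stages `E`; the nested universal
  -- quantifiers are all evaluated at that single `E`.
  replace h_cauchy (ε : PosRat) : ∃ m : ℕ, ∀ (E : Context A) (k : C ≤ E) (n n' : ℕ) (w w' : E.1),
      m ≤ n → m ≤ n' →
      (pr ⟨n⟩ w : (NatObj (Context A) ⊗ bohrification A).obj E) ∈ LocalSub.obj S E (h.trans k) →
      (pr ⟨n'⟩ w' : (NatObj (Context A) ⊗ bohrification A).obj E) ∈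
        LocalSub.obj S E (h.trans k) → ‖w - w'‖ < (ε.1 : ℝ) := by
    obtain ⟨m, hm⟩ := h_cauchy C le_rfl ⟨ε⟩
    refine ⟨m.down, fun E k n n' w w' hn hn' hw hw' => ?_⟩
    rw [sub_eq_add_neg]
    exact hm E k ⟨n⟩ E le_rfl ⟨n'⟩ E le_rfl w E le_rfl w' E le_rfl ⟨⟨hn, hn'⟩, hw, hw'⟩
  choose x hx using fun n : ℕ => h_inh C le_rfl ⟨n⟩
  let x' : ℕ → C.1 := x
  have : CompleteSpace C.1 := C.2.1.completeSpace_coe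
  have h_seq : CauchySeq x' := by
    refine Metric.cauchySeq_iff.2 fun ε hε => ?_
    obtain ⟨q, hq, hqε⟩ := exists_rat_btwn hε
    obtain ⟨m, hm⟩ := h_cauchy ⟨q, Rat.cast_pos.1 hq⟩
    refine ⟨m, fun n hn n' hn' => ?_⟩
    rw [dist_eq_norm]
    exact (hm C le_rfl n n' (x' n) (x' n') hn hn' (hx n) (hx n')).trans hqε
  obtain ⟨y, hy⟩ := cauchySeq_tendsto_of_complete h_seq
  refine ⟨y, fun D k ε => ?_⟩
  -- Half of `ε`, since passing to the limit turns the strict bound into a weak one.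
  obtain ⟨m, hm⟩ := h_cauchy ⟨ε.down.1 / 2, half_pos ε.down.2⟩
  refine ⟨⟨m⟩, ?_⟩
  rintro E₁ k₁ n E₂ k₂ w₂ E k₃ ⟨hn, hw⟩
  have hCE : C ≤ E := k.trans (k₁.trans (k₂.trans k₃))
  let w : E.1 := res (bohrification A) k₃ w₂
  -- The limit is taken in `A`, the common home of `w` from `E` and of the sequence from `C`.
  have hA : Filter.Tendsto (fun n' => ‖(w : A) - (x' n' : A)‖) Filter.atTop
      (nhds ‖(w : A) - (y : A)‖) :=
    (tendsto_const_nhds.sub ((continuous_subtype_val.tendsto y).comp hy)).norm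
  have h_le : ‖(w : A) - (y : A)‖ ≤ ((ε.down.1 / 2 : ℚ) : ℝ) := by
    refine le_of_tendsto hA (Filter.eventually_atTop.2 ⟨m, fun n' hn' => ?_⟩)
    exact (hm E hCE n.down n' w ⟨x' n', hCE (x' n').2⟩ hn hn' hw
      (LocalSub.map S C E h hCE _ (hx n'))).le
  have h_lt : ‖(w : A) - (y : A)‖ < (ε.down.1 : ℝ) :=
    h_le.trans_lt (Rat.cast_lt.2 (half_lt_self ε.down.2))
  rw [sub_eq_add_neg] at h_lt
  exact h_lt

end Bohrification

theorem theorem3p3 (A : Type u) [CStarAlgebra A] :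
    -- the internal complex numbers are the constant functor `ℂ`
    IsIso (ofComplex (P := Context A)) ∧
    ∃ r : RealArith (Context A), r.IsStandard ∧
      (∀ (C : Context A) (z w : ℂ),
        r.complexScalars.add.app C (pr (ofComplex.app C ⟨z⟩) (ofComplex.app C ⟨w⟩)) =
          ofComplex.app C ⟨z + w⟩ ∧
        r.complexScalars.mul.app C (pr (ofComplex.app C ⟨z⟩) (ofComplex.app C ⟨w⟩)) =
          ofComplex.app C ⟨z * w⟩ ∧
        r.complexScalars.conj.app C (ofComplex.app C ⟨z⟩) =
          ofComplex.app C ⟨starRingEnd ℂ z⟩) ∧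
      ∃ (a : StarAlgData (PtComplex (Context A)) (bohrification A))
        (N : bohrification A ⊗ PosRatObj (Context A) ⟶ Omega (Context A)),
        -- the operations and the norm relation are inherited from `A`
        (∀ (C : Context A) (x y : C.1) (z : ℂ) (q : PosRat),
          a.zero.app C PUnit.unit = (0 : C.1) ∧
          a.one.app C PUnit.unit = (1 : C.1) ∧
          a.add.app C (pr x y) = x + y ∧
          a.neg.app C x = -x ∧
          a.smul.app C (pr (ofComplex.app C ⟨z⟩) x) = z • x ∧
          a.mul.app C (pr x y) = x * y ∧
          a.star.app C x = star x ∧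
          (Forces N C (pr x ⟨q⟩) ↔ ‖x‖ < (q.1 : ℝ))) ∧
        -- `A` is, internally, a *-algebra over the complex numbers and a commutative C*-algebra
        a.IsUnitalStarAlgebra r.complexScalars ∧
        a.IsCommutative ∧
        (a.restrictScalars gaussIncl).IsUnitalCStarAlgebra N := by
  refine ⟨inferInstance, realArith _, realArith_isStandard, fun C z w =>
    ⟨complexScalars_add C z w, complexScalars_mul C z w, complexScalars_conj C z⟩,
    bohrificationAlg (inv ofComplex), bohrificationNorm A, fun C x y z q =>
      ⟨rfl, rfl, rfl, rfl, bohrificationAlg_smul C z x, rfl, rfl,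
        forces_bohrificationNorm C x ⟨q⟩⟩,
    bohrificationAlg_isUnitalStarAlgebra_complex, bohrificationAlg_isCommutative _, ?_⟩
  rw [bohrificationAlg_restrictScalars_gaussIncl]
  exact ⟨bohrificationAlg_isUnitalStarAlgebra_gauss, bohrificationAlg_isPreSemiCStar,
    bohrificationAlg_isNorm _, bohrificationAlg_isCauchyComplete _⟩
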